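/- Let $d\in\mathbb N$ and let $\mathbb P_d$ be the set of $d\times d$ complex (Hermitian) positive definite matrices. For $P,Q,R\in\mathbb P_d$ define the (a priori complex) generalized fidelity \[ F_R(P,Q):=\operatorname{Tr}\!\left[\bigl(R^{1/2}PR^{1/2}\bigr)^{1/2}R^{-1}\bigl(R^{1/2}QR^{1/2}\bigr)^{1/2}\right], \] and, for $x\in\mathbb R$, $F^{\mathrm{pol}}_x(P,Q):=\tfrac12\bigl(F_{P^x}(P,Q)+F_{Q^x}(P,Q)\bigr)$. Let \[ F^{\mathrm U}(P,Q):=\operatorname{Tr}\bigl[(P^{1/2}QP^{1/2})^{1/2}\bigr],\qquad F^{\mathrm M}(P,Q):=\operatorname{Tr}\bigl[P^{1/2}(P^{-1/2}QP^{-1/2})^{1/2}P^{1/2}\bigr] \] be the Uhlmann and Matsumoto fidelities, which are real numbers. (i) For all $P,Q\in\mathbb P_d$, as subsets of $\mathbb C$, \[ \{F_{P^x}(P,Q):x\in[-1,1]\}=\{F_{Q^x}(P,Q):x\in[-1,1]\}=\{F^{\mathrm{pol}}_x(P,Q):x\in[-1,1]\}=[F^{\mathrm M}(P,Q),F^{\mathrm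 U}(P,Q)]. \] In particular, for every $x\in[-1,1]$ the number $F^{\mathrm{pol}}_x(P,Q)$ is real and $F^{\mathrm M}(P,Q)\le F^{\mathrm{pol}}_x(P,Q)\le F^{\mathrm U}(P,Q)$. (ii) Let $\mathcal F:\mathbb P_d\times\mathbb P_d\to\mathbb R$ be any function with $F^{\mathrm M}(P,Q)\le\mathcal F(P,Q)\le F^{\mathrm U}(P,Q)$ for all $P,Q\in\mathbb P_d$. Then for every pair $P,Q\in\mathbb P_d$ there exist parameters $\theta_P,\theta_Q,\vartheta\in[-1,1]$ (depending on $\mathcal F,P,Q$) such that \[ \mathcal F(P,Q)=F_{P^{\theta_P}}(P,Q)=F_{Q^{\theta_Q}}(P,Q)=F^{\mathrm{pol}}_{\vartheta}(P,Q). \] These parameters are in general not unique: if $PQ=QP$, then $\mathcal F(P,Q)=F_{P^x}(P,Q)=F_{Q^x}(P,Q)=F^{\mathrm{pol}}_x(P,Q)$ for every $x\in[-1,1]$. -/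

import Mathlib

open scoped ComplexOrder MatrixOrder

noncomputable section

/-- The cone `ℙ_d` of `d × d` complex (Hermitian) positive definite matrices. -/
abbrev PDMatrix (d : ℕ) : Type := {A : Matrix (Fin d) (Fin d) ℂ // A.PosDef}

/-- The generalized fidelity with base `R`,
`F_R(P, Q) = Tr[(R^{1/2} P R^{1/2})^{1/2} R⁻¹ (R^{1/2} Q R^{1/2})^{1/2}]`, a complex number.
Real powers of a positive semidefinite matrix are those of the functional calculus. -/
def generalizedFidelity {d : ℕ} (R P Q : Matrix (Fin d) (Fin d) ℂ) : ℂ :=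
  Matrix.trace
    ((R ^ (1 / 2 : ℝ) * P * R ^ (1 / 2 : ℝ)) ^ (1 / 2 : ℝ) * R⁻¹ *
      (R ^ (1 / 2 : ℝ) * Q * R ^ (1 / 2 : ℝ)) ^ (1 / 2 : ℝ))

/-- The symmetrized polar fidelity `(F_{P^x}(P, Q) + F_{Q^x}(P, Q)) / 2`. -/
def polarFidelity {d : ℕ} (x : ℝ) (P Q : Matrix (Fin d) (Fin d) ℂ) : ℂ :=
  (generalizedFidelity (P ^ x) P Q + generalizedFidelity (Q ^ x) P Q) / 2

/-- The Uhlmann fidelity `F^U(P, Q) = Tr[(P^{1/2} Q P^{1/2})^{1/2}]`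
(the trace is real, see `ofReal_uhlmannFidelity`). -/
def uhlmannFidelity {d : ℕ} (P Q : Matrix (Fin d) (Fin d) ℂ) : ℝ :=
  (Matrix.trace ((P ^ (1 / 2 : ℝ) * Q * P ^ (1 / 2 : ℝ)) ^ (1 / 2 : ℝ))).re

/-- The Matsumoto fidelity: the trace of the matrix geometric mean,
`F^M(P, Q) = Tr[P^{1/2} (P^{-1/2} Q P^{-1/2})^{1/2} P^{1/2}]`
(the trace is real, see `ofReal_matsumotoFidelity`). -/
def matsumotoFidelity {d : ℕ} (P Q : Matrix (Fin d) (Fin d) ℂ) : ℝ :=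
  (Matrix.trace
    (P ^ (1 / 2 : ℝ) * (P ^ (-(1 / 2) : ℝ) * Q * P ^ (-(1 / 2) : ℝ)) ^ (1 / 2 : ℝ) *
      P ^ (1 / 2 : ℝ))).re

theorem ofReal_re_trace_of_nonneg {d : ℕ} {A : Matrix (Fin d) (Fin d) ℂ} (hA : 0 ≤ A) :
    ((Matrix.trace A).re : ℂ) = Matrix.trace A := by
  have h : A.IsHermitian := (Matrix.nonneg_iff_posSemidef.mp hA).isHermitian
  apply Complex.conj_eq_iff_re.mp
  have := Matrix.trace_conjTranspose A
  rw [h.eq] at this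
  exact this.symm

theorem ofReal_uhlmannFidelity {d : ℕ} (P Q : Matrix (Fin d) (Fin d) ℂ) :
    (uhlmannFidelity P Q : ℂ) =
      Matrix.trace ((P ^ (1 / 2 : ℝ) * Q * P ^ (1 / 2 : ℝ)) ^ (1 / 2 : ℝ)) :=
  ofReal_re_trace_of_nonneg CFC.rpow_nonneg

theorem ofReal_matsumotoFidelity {d : ℕ} (P Q : Matrix (Fin d) (Fin d) ℂ) :
    (matsumotoFidelity P Q : ℂ) =
      Matrix.trace
        (P ^ (1 / 2 : ℝ) * (P ^ (-(1 / 2) : ℝ) * Q * P ^ (-(1 / 2) : ℝ)) ^ (1 / 2 : ℝ) *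
          P ^ (1 / 2 : ℝ)) := by
  apply ofReal_re_trace_of_nonneg
  have h : IsSelfAdjoint (P ^ (1 / 2 : ℝ)) := IsSelfAdjoint.of_nonneg CFC.rpow_nonneg
  exact h.conjugate_nonneg CFC.rpow_nonneg

end

/-!
Collecting powers of `P` turns the generalized fidelity into
`F_{P^x}(P, Q) = Tr[P^{(1-x)/2} (P^{x/2} Q P^{x/2})^{1/2}]` (`Matrix.fidelityPath`). It is real,
being the trace of a product of two Hermitian matrices; at `x = 1` it is the Uhlmann fidelity and at
`x = -1` the Matsumoto fidelity. It is also continuous and nondecreasing in `x ∈ [-1, 1]`, so its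
image is exactly `[F^M, F^U]` by the intermediate value theorem. Since `F_{Q^x}(P, Q)` is the same
curve with `P` and `Q` exchanged and both `F^U` and `F^M` are symmetric, it has the same endpoints,
and so has the average of the two curves. Part (ii) is a restatement of this, together with
`F^M = F^U` for commuting matrices.

The heart of the matter is monotonicity (`Matrix.PosDef.monotoneOn_re_fidelityPath`). Write
`X = (P^{x/2} Q P^{x/2})^{1/2}`, `L = log P` and `K = P^{(1-x)/2}`. Differentiating
`X² = P^{x/2} Q P^{x/2}` shows that `V = 2 X'` solves the Lyapunov equation
`X V + V X = L X² + X² L`, and the derivative of the fidelity is `½ Re Tr[K (V - L X)]`. In an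
eigenbasis of `P`, where `K` and `L` are diagonal with entries `k_a` and `l_a`, one solves the
equation explicitly in terms of the positive semidefinite solutions of `X T + T X = E_aa` and finds
`Re Tr[K (V - L X)] = ½ ∑ (k_a - k_b) (l_a - l_b) N_ab` with a symmetric matrix `N_ab ≥ 0`
(`Matrix.PosDef.re_trace_diagonal_mul_le`). For `x ≤ 1` the entries `k` and `l` are comonotone, so
the derivative is nonnegative.

The Uhlmann fidelity is symmetric because `Aᴴ A` and `A Aᴴ` have square roots of the same trace, and
the Matsumoto fidelity because the geometric mean of `P` and `Q` is the unique positive semidefinite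
solution of `C P⁻¹ C = Q`, an equation which is equivalent to `C Q⁻¹ C = P`.
-/

namespace Matrix

/-! ### The Lyapunov equation -/

section Lyapunov

variable {n : Type*} [Fintype n] [DecidableEq n] {X : Matrix n n ℂ}

theorem PosDef.eq_zero_of_mul_add_mul_eq_zero (hX : X.PosDef) {V : Matrix n n ℂ}
    (hV : X * V + V * X = 0) : V = 0 := by
  have h₁ : (Vᴴ * X * V).PosSemidef := hX.posSemidef.conjTranspose_mul_mul_same V
  have h₂ : (V * X * Vᴴ).PosSemidef := hX.posSemidef.mul_mul_conjTranspose_same V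
  have hsum : (Vᴴ * X * V).trace + (V * X * Vᴴ).trace = 0 := by
    have : (Vᴴ * (X * V + V * X)).trace = 0 := by rw [hV, mul_zero, trace_zero]
    rw [mul_add, trace_add] at this
    rw [trace_mul_comm (V * X) Vᴴ, mul_assoc]
    exact this
  have htr : (Vᴴ * X * V).trace = 0 :=
    ((add_eq_zero_iff_of_nonneg h₁.trace_nonneg h₂.trace_nonneg).mp hsum).1
  have h0 : Vᴴ * X * V = 0 := h₁.trace_eq_zero_iff.mp htr
  refine Matrix.ext_of_mulVec_single fun i => ?_
  rw [zero_mulVec]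
  by_contra hne
  have hpos := hX.dotProduct_mulVec_pos hne
  have : star (V *ᵥ Pi.single i 1) ⬝ᵥ (X *ᵥ (V *ᵥ Pi.single i 1)) = 0 := by
    rw [star_mulVec, ← dotProduct_mulVec, mulVec_mulVec, mulVec_mulVec, h0,
      zero_mulVec, dotProduct_zero]
  exact hpos.ne' this

theorem PosDef.mul_add_mul_injective (hX : X.PosDef) {V W : Matrix n n ℂ}
    (h : X * V + V * X = X * W + W * X) : V = W := by
  refine sub_eq_zero.mp (hX.eq_zero_of_mul_add_mul_eq_zero ?_)
  rw [mul_sub, sub_mul, sub_add_sub_comm, h, sub_self]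

theorem PosDef.exists_mul_add_mul_eq (hX : X.PosDef) (W : Matrix n n ℂ) :
    ∃ V : Matrix n n ℂ, X * V + V * X = W := by
  have hinj : Function.Injective (LinearMap.mulLeft ℂ X + LinearMap.mulRight ℂ X) :=
    fun V W h => hX.mul_add_mul_injective h
  exact LinearMap.surjective_of_injective hinj W

/-- Lyapunov's theorem: on an eigenvector `v` of `T` with eigenvalue `t`, the quadratic form of
`X * T + T * X` is `2 t ⟨v, X v⟩`. -/
theorem PosDef.posSemidef_of_mul_add_mul (hX : X.PosDef) {T K : Matrix n n ℂ}
    (hK : K.PosSemidef) (hT : X * T + T * X = K) : T.PosSemidef := by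
  have hTh : T.IsHermitian := by
    -- `Tᴴ` solves the same equation as `T`.
    refine hX.mul_add_mul_injective (V := Tᴴ) ?_
    have := congrArg Matrix.conjTranspose hT
    rw [conjTranspose_add, conjTranspose_mul, conjTranspose_mul, hX.isHermitian.eq,
      hK.isHermitian.eq] at this
    rw [hT, add_comm, this]
  refine hTh.posSemidef_iff_eigenvalues_nonneg.mpr fun i => ?_
  set v : n → ℂ := ⇑(hTh.eigenvectorBasis i) with hv
  have hv0 : v ≠ 0 := by
    intro h
    exact hTh.eigenvectorBasis.orthonormal.ne_zero i (by ext j; exact congrFun h j)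
  have hTv : T *ᵥ v = (hTh.eigenvalues i) • v := hTh.mulVec_eigenvectorBasis i
  have hvT : star v ᵥ* T = (hTh.eigenvalues i) • star v := by
    have := congrArg star hTv
    rw [star_mulVec, hTh.eq] at this
    rw [this]; ext j; simp
  have hq := hK.re_dotProduct_nonneg v
  have hp := hX.re_dotProduct_pos hv0
  have : star v ⬝ᵥ (K *ᵥ v)
      = (hTh.eigenvalues i) • (star v ⬝ᵥ (X *ᵥ v)) +
        (hTh.eigenvalues i) • (star v ⬝ᵥ (X *ᵥ v)) := by
    rw [← hT, add_mulVec, dotProduct_add, ← mulVec_mulVec, ← mulVec_mulVec, hTv, mulVec_smul,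
      dotProduct_smul, dotProduct_mulVec (star v) T, hvT, smul_dotProduct]
  rw [this] at hq
  simp only [map_add, RCLike.smul_re] at hq
  have : 0 ≤ hTh.eigenvalues i * RCLike.re (star v ⬝ᵥ (X *ᵥ v)) := by linarith
  exact nonneg_of_mul_nonneg_left this hp

end Lyapunov

/-! ### The trace inequality for comonotone functions of one matrix -/

section Comonotone

variable {n : Type*} [Fintype n]

theorem re_trace_diagonal_mul [DecidableEq n] (k : n → ℝ) (Y : Matrix n n ℂ) :
    (trace (diagonal (fun a => (k a : ℂ)) * Y)).re = ∑ a, k a * (Y a a).re := by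
  simp [trace, diagonal_mul, Complex.re_sum]

/-- By the symmetry of `N`, twice the sum is `∑ (k a - k b) (l a - l b) N a b`. -/
theorem _root_.Monovary.sum_mul_sum_sub_mul_nonneg {k l : n → ℝ} (hkl : Monovary k l)
    {N : n → n → ℝ} (hN : ∀ a b, 0 ≤ N a b) (hNs : ∀ a b, N a b = N b a) :
    0 ≤ ∑ a, k a * ∑ b, (l a - l b) * N a b := by
  have h₁ : ∑ a, k a * ∑ b, (l a - l b) * N a b = ∑ a, ∑ b, k a * ((l a - l b) * N a b) := by
    simp_rw [Finset.mul_sum]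
  have h₂ : ∑ a, k a * ∑ b, (l a - l b) * N a b = ∑ a, ∑ b, k b * ((l b - l a) * N a b) := by
    rw [h₁, Finset.sum_comm]
    simp_rw [fun a b => hNs b a]
  have h₃ : 0 ≤ ∑ a, ∑ b, (k a - k b) * (l a - l b) * N a b :=
    Finset.sum_nonneg fun a _ => Finset.sum_nonneg fun b _ =>
      mul_nonneg (by simpa using monovary_iff_forall_mul_nonneg.mp hkl b a) (hN a b)
  have h₄ : ∑ a, ∑ b, (k a - k b) * (l a - l b) * N a b
      = (∑ a, ∑ b, k a * ((l a - l b) * N a b)) + ∑ a, ∑ b, k b * ((l b - l a) * N a b) := by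
    rw [← Finset.sum_add_distrib]
    refine Finset.sum_congr rfl fun a _ => ?_
    rw [← Finset.sum_add_distrib]
    exact Finset.sum_congr rfl fun b _ => by ring
  rw [h₄, ← h₁, ← h₂] at h₃
  linarith

/-- If `V` solves `X V + V X = L X² + X² L` and `K`, `L` are diagonal with comonotone entries, then
`Re Tr (K L X) ≤ Re Tr (K V)`.

Let `T b ≥ 0` solve `X (T b) + (T b) X = E_bb`, where `E_bb` is the matrix unit. Then
`V = L X + X L - 2 ∑ l_b X (T b) X` and `X = 2 ∑ X (T b) X`, so for `N a b = 2 (X (T b) X)_aa` the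
difference of the two sides is `∑ k_a (l_a - l_b) N a b`. The matrix `N` has nonnegative entries and
is symmetric, because the inverse Lyapunov operator is self-adjoint for the trace form. -/
theorem PosDef.re_trace_diagonal_mul_le [DecidableEq n] {X : Matrix n n ℂ} (hX : X.PosDef)
    {k l : n → ℝ} (hkl : Monovary k l)
    {V : Matrix n n ℂ}
    (hV : X * V + V * X = diagonal (fun a => (l a : ℂ)) * (X * X) +
      X * X * diagonal (fun a => (l a : ℂ))) :
    (trace (diagonal (fun a => (k a : ℂ)) * (diagonal (fun a => (l a : ℂ)) * X))).re ≤
      (trace (diagonal (fun a => (k a : ℂ)) * V)).re := by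
  set L : Matrix n n ℂ := diagonal (fun a => (l a : ℂ)) with hL
  have hE (a : n) : (single a a (1 : ℂ)).PosSemidef := by
    rw [← diagonal_single]
    refine PosSemidef.diagonal ?_
    intro b
    by_cases hb : b = a
    · subst hb; simp
    · simp [hb]
  choose T hT using fun a => hX.exists_mul_add_mul_eq (single a a (1 : ℂ))
  have hTpos (a : n) : (T a).PosSemidef := hX.posSemidef_of_mul_add_mul (hE a) (hT a)
  have hsolve (c : n → ℂ) : X * (∑ b, (2 * c b) • (X * T b * X)) +
      (∑ b, (2 * c b) • (X * T b * X)) * X = (2 : ℂ) • (X * diagonal c * X) := by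
    have hc : diagonal c = ∑ b, c b • single b b (1 : ℂ) := by
      simp [Matrix.smul_single, sum_single_eq_diagonal]
    rw [hc, Finset.mul_sum, Finset.sum_mul, ← Finset.sum_add_distrib, Finset.mul_sum,
      Finset.sum_mul, Finset.smul_sum]
    refine Finset.sum_congr rfl fun b _ => ?_
    rw [← hT b]
    simp only [mul_smul_comm, smul_mul_assoc, mul_add, add_mul, smul_add, smul_smul, mul_assoc]
  have hVeq : V = L * X + X * L - ∑ b, (2 * (l b : ℂ)) • (X * T b * X) := by
    refine hX.mul_add_mul_injective ?_
    rw [hV, mul_sub, sub_mul, sub_add_sub_comm, hsolve fun b => (l b : ℂ), ← hL, two_smul]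
    noncomm_ring
  have hXeq : X = ∑ b, (2 * 1 : ℂ) • (X * T b * X) := by
    refine hX.mul_add_mul_injective ?_
    rw [hsolve fun _ => (1 : ℂ), two_smul, diagonal_one, mul_one]
  set N : n → n → ℝ := fun a b => 2 * ((X * T b * X) a a).re with hN
  have hN0 (a b : n) : 0 ≤ N a b := by
    have : (X * T b * X).PosSemidef := by
      have := (hTpos b).conjTranspose_mul_mul_same X
      rwa [hX.isHermitian.eq] at this
    exact mul_nonneg zero_le_two (Complex.le_def.mp (this.diag_nonneg (i := a))).1
  have hNs (a b : n) : N a b = N b a := by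
    have key (a b : n) : ((X * T b * X) a a) =
        trace (T a * (X * (X * T b * X) + (X * T b * X) * X)) := by
      have : ((X * T b * X) a a) = trace (single a a (1 : ℂ) * (X * T b * X)) := by
        simp [trace_single_mul]
      rw [this, ← hT a, add_mul, mul_add, trace_add, trace_add, add_comm, mul_assoc (T a) X,
        mul_assoc X (T a), trace_mul_comm X, mul_assoc (T a) _ X]
    have hs (b : n) : X * (X * T b * X) + (X * T b * X) * X = X * single b b 1 * X := by
      rw [← hT b]; noncomm_ring
    have : ((X * T b * X) a a) = ((X * T a * X) b b) := by
      have hb : (X * T a * X) b b = trace ((X * T a * X) * single b b (1 : ℂ)) := by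
        simp [trace_mul_single]
      rw [key, hs, hb, trace_mul_comm (T a), mul_assoc, mul_assoc, trace_mul_comm X,
        trace_mul_comm _ (single b b 1)]
      simp only [mul_assoc]
    simp only [hN, this]
  have hXa (a : n) : (X a a).re = ∑ b, N a b := by
    conv_lhs => rw [hXeq]
    simp [Matrix.sum_apply, hN]
  have hVa (a : n) : (V a a).re = 2 * l a * (X a a).re - ∑ b, l b * N a b := by
    rw [hVeq]
    simp [Matrix.sum_apply, hN, hL, diagonal_mul, mul_diagonal]
    ring_nf
  rw [re_trace_diagonal_mul, re_trace_diagonal_mul, ← sub_nonneg, ← Finset.sum_sub_distrib]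
  refine (hkl.sum_mul_sum_sub_mul_nonneg hN0 hNs).trans_eq (Finset.sum_congr rfl fun a _ => ?_)
  rw [← mul_sub, hVa, hL, diagonal_mul]
  congr 1
  simp_rw [sub_mul, Finset.sum_sub_distrib, ← Finset.mul_sum, ← hXa]
  rw [Complex.re_ofReal_mul]
  ring

end Comonotone


/-! ### Real powers of positive definite matrices -/

section Powers

theorem IsHermitian.im_trace_mul_eq_zero
    {n : Type*} [Fintype n] {A B : Matrix n n ℂ} (hA : A.IsHermitian)
    (hB : B.IsHermitian) : (trace (A * B)).im = 0 := by
  refine Complex.conj_eq_iff_im.mp ?_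
  have := trace_conjTranspose (A * B)
  rw [conjTranspose_mul, hA.eq, hB.eq, trace_mul_comm] at this
  exact this.symm

variable {n : Type*} [Fintype n] [DecidableEq n] {P : Matrix n n ℂ}

theorem PosDef.rpow (hP : P.PosDef) (x : ℝ) : (P ^ x).PosDef :=
  isStrictlyPositive_iff_posDef.mp (hP.isStrictlyPositive.rpow (y := x))

theorem PosDef.rpow_add (hP : P.PosDef) (x y : ℝ) : P ^ (x + y) = P ^ x * P ^ y :=
  CFC.rpow_add hP.isUnit

theorem PosDef.rpow_neg_eq_inv (hP : P.PosDef) (x : ℝ) : P ^ (-x) = (P ^ x)⁻¹ :=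
  (inv_eq_left_inv (CFC.rpow_neg_mul_rpow x hP.isStrictlyPositive)).symm

theorem PosDef.rpow_rpow (hP : P.PosDef) (x y : ℝ) : (P ^ x) ^ y = P ^ (x * y) := by
  rcases eq_or_ne x 0 with rfl | hx
  · rw [zero_mul, CFC.rpow_zero P hP.posSemidef.nonneg, CFC.one_rpow]
  · exact CFC.rpow_rpow P x y hx hP.isStrictlyPositive

theorem PosSemidef.rpow_half_mul_self (hP : P.PosSemidef) :
    P ^ (1 / 2 : ℝ) * P ^ (1 / 2 : ℝ) = P := by
  rw [← CFC.sqrt_eq_rpow, CFC.sqrt_mul_sqrt_self P hP.nonneg]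

theorem PosSemidef.rpow_half_eq {B : Matrix n n ℂ} (hB : B.PosSemidef)
    (h : B * B = P) : P ^ (1 / 2 : ℝ) = B := by
  have hP : 0 ≤ P := by
    have := (posSemidef_conjTranspose_mul_self B).nonneg
    rwa [hB.isHermitian.eq, h] at this
  rw [← CFC.sqrt_eq_rpow]
  exact CFC.sqrt_unique h hB.nonneg

/-- The spectral theorem for functions of `P`. -/
theorem PosDef.cfc_eq_conj (hP : P.PosDef) (f : ℝ → ℝ) :
    cfc f P = (hP.isHermitian.eigenvectorUnitary : Matrix n n ℂ) *
      diagonal (fun a => ((f (hP.isHermitian.eigenvalues a) : ℝ) : ℂ)) *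
      star (hP.isHermitian.eigenvectorUnitary : Matrix n n ℂ) := by
  rw [hP.isHermitian.cfc_eq, IsHermitian.cfc, Unitary.conjStarAlgAut_apply]
  rfl

theorem PosDef.rpow_eq_conj (hP : P.PosDef) (x : ℝ) :
    P ^ x = (hP.isHermitian.eigenvectorUnitary : Matrix n n ℂ) *
      diagonal (fun a => ((hP.isHermitian.eigenvalues a ^ x : ℝ) : ℂ)) *
      star (hP.isHermitian.eigenvectorUnitary : Matrix n n ℂ) := by
  rw [CFC.rpow_eq_cfc_real hP.posSemidef.nonneg, hP.cfc_eq_conj]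

/-- The inequality behind the monotonicity of the fidelities: `P ^ c` and `log P` are simultaneously
diagonal in an eigenbasis of `P`, with comonotone eigenvalues. -/
theorem PosDef.re_trace_rpow_mul_log_mul_le (hP : P.PosDef) {X V : Matrix n n ℂ} (hX : X.PosDef)
    {c : ℝ} (hc : 0 ≤ c)
    (hV : X * V + V * X = cfc Real.log P * (X * X) + X * X * cfc Real.log P) :
    (trace (P ^ c * (cfc Real.log P * X))).re ≤ (trace (P ^ c * V)).re := by
  set U : Matrix n n ℂ := (hP.isHermitian.eigenvectorUnitary : Matrix n n ℂ) with hU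
  have hUU : star U * U = 1 := Unitary.coe_star_mul_self _
  have hUU' : U * star U = 1 := Unitary.coe_mul_star_self _
  have hlog := hP.cfc_eq_conj Real.log
  have hpow := hP.rpow_eq_conj c
  rw [← hU] at hlog hpow
  set l : n → ℝ := fun a => Real.log (hP.isHermitian.eigenvalues a) with hl
  set k : n → ℝ := fun a => hP.isHermitian.eigenvalues a ^ c with hk
  have hkl : Monovary k l := by
    intro a b hab
    have := (Real.log_lt_log_iff (hP.eigenvalues_pos a) (hP.eigenvalues_pos b)).mp hab
    exact Real.rpow_le_rpow (hP.eigenvalues_pos a).le this.le hc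
  have hX' : (star U * X * U).PosDef :=
    (IsUnit.posDef_star_left_conjugate_iff (IsUnit.of_mul_eq_one _ hUU')).mpr hX
  have hcancel (Y : Matrix n n ℂ) : U * (star U * Y) = Y := by rw [← mul_assoc, hUU', one_mul]
  have hcancel' (Y : Matrix n n ℂ) : star U * (U * Y) = Y := by rw [← mul_assoc, hUU, one_mul]
  have key := hX'.re_trace_diagonal_mul_le hkl (V := star U * V * U) (by
    have := congrArg (fun Y => star U * Y * U) hV
    rw [hlog] at this
    simp only [mul_add, add_mul, mul_assoc, hcancel, hcancel', hUU, mul_one] at this ⊢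
    exact this)
  have htr (Y : Matrix n n ℂ) : trace (U * Y * star U) = trace Y := by
    rw [trace_mul_comm, ← mul_assoc, hUU, one_mul]
  have h₁ : trace (P ^ c * (cfc Real.log P * X)) =
      trace (diagonal (fun a => (k a : ℂ)) *
        (diagonal (fun a => (l a : ℂ)) * (star U * X * U))) := by
    rw [← htr (diagonal _ * _), hpow, hlog]
    simp only [mul_assoc, hcancel', hUU', mul_one]
    rfl
  have h₂ : trace (P ^ c * V) =
      trace (diagonal (fun a => (k a : ℂ)) * (star U * V * U)) := by
    rw [← htr (diagonal _ * _), hpow]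
    simp only [mul_assoc, hUU', mul_one]
    rfl
  rw [h₁, h₂]
  exact key

theorem PosDef.commute_log_rpow (x : ℝ) (hP : P.PosDef) :
    cfc Real.log P * P ^ x = P ^ x * cfc Real.log P := by
  rw [CFC.rpow_eq_cfc_real hP.posSemidef.nonneg]
  exact cfc_commute_cfc _ _ P

end Powers

/-! ### Derivatives of powers and square roots -/

section Calculus

open scoped Matrix.Norms.L2Operator Topology

variable {n : Type*} [Fintype n] [DecidableEq n] {P : Matrix n n ℂ}

theorem PosDef.hasDerivAt_rpow (hP : P.PosDef) (x : ℝ) :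
    HasDerivAt (fun y : ℝ => P ^ y) (cfc Real.log P * P ^ x) x := by
  have hd (a : n) : HasDerivAt (fun y : ℝ => ((hP.isHermitian.eigenvalues a ^ y : ℝ) : ℂ))
      ((Real.log (hP.isHermitian.eigenvalues a) * hP.isHermitian.eigenvalues a ^ x : ℝ) : ℂ) x := by
    have := (Real.hasStrictDerivAt_const_rpow (hP.eigenvalues_pos a) x).hasDerivAt.ofReal_comp
    rwa [mul_comm] at this
  have hD := ((LinearMap.toContinuousLinearMap
    ((diagonalLinearMap n ℂ ℂ).restrictScalars ℝ)).hasFDerivAt.comp_hasDerivAt x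
      (hasDerivAt_pi.mpr hd))
  have := (hD.const_mul (hP.isHermitian.eigenvectorUnitary : Matrix n n ℂ)).mul_const
    (star (hP.isHermitian.eigenvectorUnitary : Matrix n n ℂ))
  have hfun : (fun y : ℝ => P ^ y) = fun y => (hP.isHermitian.eigenvectorUnitary : Matrix n n ℂ) *
      diagonal (fun a => ((hP.isHermitian.eigenvalues a ^ y : ℝ) : ℂ)) *
      star (hP.isHermitian.eigenvectorUnitary : Matrix n n ℂ) :=
    funext hP.rpow_eq_conj
  have hval : cfc Real.log P * P ^ x = (hP.isHermitian.eigenvectorUnitary : Matrix n n ℂ) *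
      diagonal (fun a => ((Real.log (hP.isHermitian.eigenvalues a) *
        hP.isHermitian.eigenvalues a ^ x : ℝ) : ℂ)) *
      star (hP.isHermitian.eigenvectorUnitary : Matrix n n ℂ) := by
    rw [CFC.rpow_eq_cfc_real hP.posSemidef.nonneg, ← cfc_mul _ _ P
      (by rw [continuousOn_iff_continuous_domRestrict]; fun_prop)
      (by rw [continuousOn_iff_continuous_domRestrict]; fun_prop), hP.cfc_eq_conj]
  rw [hfun, hval]
  exact this

theorem continuous_rpow_half {W : ℝ → Matrix n n ℂ} (hW : Continuous W)
    (hpos : ∀ x, (W x).PosSemidef) : Continuous fun x => W x ^ (1 / 2 : ℝ) := by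
  have := hW.cfc_nnreal_of_mem_nhdsSet (s := Set.univ) (fun t : NNReal => t ^ (1 / 2 : ℝ))
    Filter.univ_mem (fun x => (hpos x).nonneg)
    (NNReal.continuous_rpow_const (by norm_num)).continuousOn
  exact this

/-- The derivative of the square root along a curve of positive definite matrices solves the
differentiated equation `X ^ 2 = W`. The square root is not a left inverse of squaring on a
neighbourhood in the space of all matrices, so differentiability comes from the local inverse of
squaring at `X`, with which the continuous curve of square roots agrees near the given point. -/
theorem exists_hasDerivAt_rpow_half {W : ℝ → Matrix n n ℂ} (hW : Continuous W)
    (hpos : ∀ x, (W x).PosDef) {x : ℝ} {W' : Matrix n n ℂ} (hW' : HasDerivAt W W' x) :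
    ∃ V : Matrix n n ℂ, W x ^ (1 / 2 : ℝ) * V + V * W x ^ (1 / 2 : ℝ) = W' ∧
      HasDerivAt (fun y => W y ^ (1 / 2 : ℝ)) V x := by
  set X := W x ^ (1 / 2 : ℝ) with hXdef
  have hX : X.PosDef := (hpos x).rpow _
  have hsq (y : ℝ) : W y ^ (1 / 2 : ℝ) * W y ^ (1 / 2 : ℝ) = W y :=
    (hpos y).posSemidef.rpow_half_mul_self
  have hcont : Continuous fun y => W y ^ (1 / 2 : ℝ) :=
    continuous_rpow_half hW fun y => (hpos y).posSemidef
  let S : Matrix n n ℂ →ₗ[ℝ] Matrix n n ℂ := LinearMap.mulLeft ℝ X + LinearMap.mulRight ℝ X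
  have hS : Function.Injective S := fun V V' h => hX.mul_add_mul_injective h
  let e : Matrix n n ℂ ≃L[ℝ] Matrix n n ℂ :=
    (LinearEquiv.ofInjectiveEndo S hS).toContinuousLinearEquiv
  have he (V : Matrix n n ℂ) : e V = X * V + V * X := rfl
  have hf : HasStrictFDerivAt (fun Y : Matrix n n ℂ => Y * Y)
      (e : Matrix n n ℂ →L[ℝ] Matrix n n ℂ) X := by
    have := (hasStrictFDerivAt_id (𝕜 := ℝ) X).mul' (hasStrictFDerivAt_id (𝕜 := ℝ) X)
    exact this
  refine ⟨e.symm W', ?_, ?_⟩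
  · rw [← he, e.apply_symm_apply]
  · have hg := hf.to_localInverse.hasFDerivAt
    have hXX : X * X = W x := hsq x
    rw [hXX] at hg
    have := hg.comp_hasDerivAt x hW'
    refine this.congr_of_eventuallyEq ?_
    have hev := hcont.continuousAt.eventually hf.eventually_left_inverse
    filter_upwards [hev] with y hy
    rw [Function.comp_apply]
    conv_rhs => rw [← hsq y]
    exact hy.symm

end Calculus


/-! ### Monotonicity of the fidelity along powers of `P` -/

section Path

open scoped Matrix.Norms.L2Operator

variable {n : Type*} [Fintype n] [DecidableEq n] {P Q : Matrix n n ℂ}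

/-- The curve `x ↦ Tr[P^{(1-x)/2} (P^{x/2} Q P^{x/2})^{1/2}]`, which is the generalized fidelity
`F_{P^x}(P, Q)` with the powers of `P` collected, see `generalizedFidelity_rpow_left`. -/
noncomputable def fidelityPath (P Q : Matrix n n ℂ) (x : ℝ) : ℂ :=
  trace (P ^ ((1 - x) / 2) * (P ^ (x / 2) * Q * P ^ (x / 2)) ^ (1 / 2 : ℝ))

theorem fidelityPath_im (P Q : Matrix n n ℂ) (x : ℝ) : (fidelityPath P Q x).im = 0 :=
  IsHermitian.im_trace_mul_eq_zero
    (nonneg_iff_posSemidef.mp CFC.rpow_nonneg).isHermitian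
    (nonneg_iff_posSemidef.mp CFC.rpow_nonneg).isHermitian

theorem PosDef.rpow_mul_mul_rpow (hP : P.PosDef) (hQ : Q.PosDef) (t : ℝ) :
    (P ^ t * Q * P ^ t).PosDef := by
  have := (IsUnit.posDef_star_left_conjugate_iff (hP.rpow t).isUnit).mpr hQ
  rwa [star_eq_conjTranspose, (hP.rpow t).isHermitian.eq] at this

theorem PosDef.hasDerivAt_rpow_conj (hP : P.PosDef) (Q : Matrix n n ℂ) (x : ℝ) :
    HasDerivAt (fun y : ℝ => P ^ (y / 2) * Q * P ^ (y / 2))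
      ((1 / 2 : ℝ) • (cfc Real.log P * (P ^ (x / 2) * Q * P ^ (x / 2)) +
        P ^ (x / 2) * Q * P ^ (x / 2) * cfc Real.log P)) x := by
  have hA : HasDerivAt (fun y : ℝ => P ^ (y / 2))
      ((1 / 2 : ℝ) • (cfc Real.log P * P ^ (x / 2))) x :=
    (hP.hasDerivAt_rpow (x / 2)).scomp x ((hasDerivAt_id x).div_const 2)
  refine ((hA.mul_const Q).mul hA).congr_deriv ?_
  rw [hP.commute_log_rpow]
  conv_lhs => enter [1]; rw [← hP.commute_log_rpow]
  simp only [smul_mul_assoc, mul_smul_comm, smul_add, mul_assoc]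

/-- With `K = P^{(1-x)/2}`, `L = log P` and `X = (P^{x/2} Q P^{x/2})^{1/2}` the derivative is
`Re Tr (K X') - Re Tr (K L X) / 2`, where `V = 2 X'` solves `X V + V X = L X² + X² L`. -/
theorem PosDef.exists_hasDerivAt_re_fidelityPath (hP : P.PosDef) (hQ : Q.PosDef) {x : ℝ}
    (hx : x ≤ 1) : ∃ c, 0 ≤ c ∧ HasDerivAt (fun y => (fidelityPath P Q y).re) c x := by
  set W : ℝ → Matrix n n ℂ := fun y => P ^ (y / 2) * Q * P ^ (y / 2) with hW
  have hWd (y : ℝ) := hP.hasDerivAt_rpow_conj Q y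
  have hWc : Continuous W := continuous_iff_continuousAt.mpr fun y => (hWd y).continuousAt
  have hWp (y : ℝ) : (W y).PosDef := hP.rpow_mul_mul_rpow hQ _
  obtain ⟨V, hV, hVd⟩ := exists_hasDerivAt_rpow_half hWc hWp (hWd x)
  set X := W x ^ (1 / 2 : ℝ) with hX
  have hXX : X * X = W x := (hWp x).posSemidef.rpow_half_mul_self
  have hK : HasDerivAt (fun y : ℝ => P ^ ((1 - y) / 2))
      (-(1 / 2 : ℝ) • (cfc Real.log P * P ^ ((1 - x) / 2))) x := by
    have := (hP.hasDerivAt_rpow ((1 - x) / 2)).scomp x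
      (((hasDerivAt_id x).const_sub 1).div_const 2)
    rwa [neg_div] at this
  let τ : Matrix n n ℂ →L[ℝ] ℝ := LinearMap.toContinuousLinearMap
    (Complex.reLm ∘ₗ (traceLinearMap n ℝ ℂ))
  have hd := τ.hasFDerivAt.comp_hasDerivAt x (hK.mul hVd)
  refine ⟨_, ?_, hd⟩
  have hle := hP.re_trace_rpow_mul_log_mul_le (X := X) (V := (2 : ℝ) • V)
    ((hWp x).rpow _) (c := (1 - x) / 2) (by linarith) (by
      rw [mul_smul_comm, smul_mul_assoc, ← smul_add, hV, smul_smul, hXX]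
      norm_num [hW])
  change 0 ≤ (trace (-(1 / 2 : ℝ) • (cfc Real.log P * P ^ ((1 - x) / 2)) * X +
    P ^ ((1 - x) / 2) * V)).re
  rw [hP.commute_log_rpow, trace_add, smul_mul_assoc, trace_smul, mul_assoc, Complex.add_re,
    Complex.smul_re]
  rw [mul_smul_comm, trace_smul, Complex.smul_re] at hle
  simp only [smul_eq_mul] at hle ⊢
  linarith

theorem PosDef.continuousOn_re_fidelityPath (hP : P.PosDef) (hQ : Q.PosDef) :
    ContinuousOn (fun y => (fidelityPath P Q y).re) (Set.Icc (-1) 1) := fun _ hx =>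
  let ⟨_, _, h⟩ := hP.exists_hasDerivAt_re_fidelityPath hQ hx.2
  h.continuousAt.continuousWithinAt

theorem PosDef.monotoneOn_re_fidelityPath (hP : P.PosDef) (hQ : Q.PosDef) :
    MonotoneOn (fun y => (fidelityPath P Q y).re) (Set.Icc (-1) 1) := by
  refine monotoneOn_of_deriv_nonneg (convex_Icc _ _) (hP.continuousOn_re_fidelityPath hQ) ?_ ?_
  all_goals
    intro x hx
    rw [interior_Icc] at hx
    obtain ⟨c, hc, h⟩ := hP.exists_hasDerivAt_re_fidelityPath hQ hx.2.le
  · exact h.differentiableAt.differentiableWithinAt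
  · rwa [h.deriv]

end Path

/-! ### Symmetry and the commuting case -/

section Symmetry

variable {n : Type*} [Fintype n] [DecidableEq n] {P Q : Matrix n n ℂ}

/-- The two square roots are conjugate: `A (Aᴴ A)^{1/2} A⁻¹` equals `A (Aᴴ A)^{-1/2} Aᴴ`, hence is
positive semidefinite, and it squares to `A Aᴴ`. -/
theorem trace_rpow_half_conjTranspose_mul_self {A : Matrix n n ℂ} (hA : IsUnit A) :
    trace ((Aᴴ * A) ^ (1 / 2 : ℝ)) = trace ((A * Aᴴ) ^ (1 / 2 : ℝ)) := by
  have hdet : IsUnit A.det := (isUnit_iff_isUnit_det A).mp hA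
  have hAA : (Aᴴ * A).PosDef :=
    PosDef.conjTranspose_mul_self A (mulVec_injective_of_isUnit hA)
  set X := (Aᴴ * A) ^ (1 / 2 : ℝ) with hX
  have hXX : X * X = Aᴴ * A := hAA.posSemidef.rpow_half_mul_self
  have hXp : X.PosDef := hAA.rpow _
  have hXdet : IsUnit X.det := (isUnit_iff_isUnit_det X).mp hXp.isUnit
  have hB : A * X * A⁻¹ = A * X⁻¹ * Aᴴ := by
    have h : X = X⁻¹ * (Aᴴ * A) := by rw [← hXX, nonsing_inv_mul_cancel_left _ _ hXdet]
    conv_lhs => rw [h]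
    simp only [mul_assoc, mul_nonsing_inv _ hdet, mul_one]
  have hBp : (A * X * A⁻¹).PosSemidef := by
    rw [hB]
    exact hXp.inv.posSemidef.mul_mul_conjTranspose_same A
  rw [hBp.rpow_half_eq (P := A * Aᴴ), trace_mul_comm, nonsing_inv_mul_cancel_left _ _ hdet]
  have : A * X * A⁻¹ * (A * X * A⁻¹) = A * (X * X) * A⁻¹ := by
    simp only [mul_assoc, nonsing_inv_mul_cancel_left _ _ hdet]
  rw [this, hXX]
  simp only [mul_assoc, mul_nonsing_inv _ hdet, mul_one]

/-- The geometric mean `P # Q` of two positive definite matrices, whose trace is the Matsumoto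
fidelity. -/
noncomputable def geometricMean (P Q : Matrix n n ℂ) : Matrix n n ℂ :=
  P ^ (1 / 2 : ℝ) * (P ^ (-(1 / 2) : ℝ) * Q * P ^ (-(1 / 2) : ℝ)) ^ (1 / 2 : ℝ) * P ^ (1 / 2 : ℝ)

theorem PosDef.posDef_geometricMean (hP : P.PosDef) (hQ : Q.PosDef) :
    (geometricMean P Q).PosDef :=
  hP.rpow_mul_mul_rpow ((hP.rpow_mul_mul_rpow hQ _).rpow _) _

theorem PosDef.geometricMean_mul_inv_mul (hP : P.PosDef) (hQ : Q.PosDef) :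
    geometricMean P Q * P⁻¹ * geometricMean P Q = Q := by
  have hinv : P ^ (1 / 2 : ℝ) * P⁻¹ * P ^ (1 / 2 : ℝ) = 1 := by
    have : P⁻¹ = P ^ (-1 : ℝ) := by
      rw [hP.rpow_neg_eq_inv, CFC.rpow_one P hP.posSemidef.nonneg]
    rw [this, ← hP.rpow_add, ← hP.rpow_add]
    norm_num
    exact CFC.rpow_zero P hP.posSemidef.nonneg
  have h₁ : P ^ (1 / 2 : ℝ) * P ^ (-(1 / 2) : ℝ) = 1 :=
    CFC.rpow_mul_rpow_neg _ hP.isStrictlyPositive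
  have h₂ : P ^ (-(1 / 2) : ℝ) * P ^ (1 / 2 : ℝ) = 1 :=
    CFC.rpow_neg_mul_rpow _ hP.isStrictlyPositive
  have hY := (hP.rpow_mul_mul_rpow hQ (-(1 / 2))).posSemidef.rpow_half_mul_self
  unfold geometricMean
  set Y := (P ^ (-(1 / 2) : ℝ) * Q * P ^ (-(1 / 2) : ℝ)) ^ (1 / 2 : ℝ)
  set A := P ^ (1 / 2 : ℝ)
  calc A * Y * A * P⁻¹ * (A * Y * A) = A * Y * (A * P⁻¹ * A) * Y * A := by
        simp only [mul_assoc]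
    _ = A * (Y * Y) * A := by rw [hinv, mul_one, mul_assoc A]
    _ = (A * P ^ (-(1 / 2) : ℝ)) * Q * (P ^ (-(1 / 2) : ℝ) * A) := by
        rw [hY]; simp only [mul_assoc]
    _ = Q := by rw [h₁, h₂, one_mul, mul_one]

/-- The geometric mean is the only positive semidefinite solution of the Riccati equation
`C P⁻¹ C = Q`. -/
theorem PosDef.eq_geometricMean (hP : P.PosDef) {C : Matrix n n ℂ} (hC : C.PosSemidef)
    (h : C * P⁻¹ * C = Q) : geometricMean P Q = C := by
  have h₁ : P ^ (1 / 2 : ℝ) * P ^ (-(1 / 2) : ℝ) = 1 :=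
    CFC.rpow_mul_rpow_neg _ hP.isStrictlyPositive
  have h₂ : P ^ (-(1 / 2) : ℝ) * P ^ (1 / 2 : ℝ) = 1 :=
    CFC.rpow_neg_mul_rpow _ hP.isStrictlyPositive
  have hinv : P⁻¹ = P ^ (-(1 / 2) : ℝ) * P ^ (-(1 / 2) : ℝ) := by
    rw [← hP.rpow_add]
    norm_num
    rw [hP.rpow_neg_eq_inv, CFC.rpow_one P hP.posSemidef.nonneg]
  unfold geometricMean
  set B := P ^ (-(1 / 2) : ℝ) with hB
  have hBC : (B * C * B).PosSemidef := by
    have := hC.conjTranspose_mul_mul_same B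
    rwa [(hP.rpow _).isHermitian.eq] at this
  rw [hBC.rpow_half_eq (P := B * Q * B) (by rw [← h, hinv]; simp only [mul_assoc])]
  calc P ^ (1 / 2 : ℝ) * (B * C * B) * P ^ (1 / 2 : ℝ)
      = (P ^ (1 / 2 : ℝ) * B) * C * (B * P ^ (1 / 2 : ℝ)) := by simp only [mul_assoc]
    _ = C := by rw [h₁, h₂, one_mul, mul_one]

/-- Inverting the Riccati equation `C P⁻¹ C = Q` gives `C Q⁻¹ C = P`. -/
theorem PosDef.geometricMean_comm (hP : P.PosDef) (hQ : Q.PosDef) :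
    geometricMean P Q = geometricMean Q P := by
  have hC := hP.posDef_geometricMean hQ
  have hCQ := hP.geometricMean_mul_inv_mul hQ
  refine (hQ.eq_geometricMean hC.posSemidef ?_).symm
  set C := geometricMean P Q
  have hCdet : IsUnit C.det := (isUnit_iff_isUnit_det C).mp hC.isUnit
  have hPdet : IsUnit P.det := (isUnit_iff_isUnit_det P).mp hP.isUnit
  rw [← hCQ, mul_inv_rev, mul_inv_rev, nonsing_inv_nonsing_inv _ hPdet,
    mul_nonsing_inv_cancel_left _ _ hCdet, nonsing_inv_mul_cancel_right _ _ hCdet]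

theorem PosDef.rpow_half_conj_of_commute (hP : P.PosDef) (hQ : Q.PosDef) (h : Commute P Q)
    (t : ℝ) : (P ^ t * Q * P ^ t) ^ (1 / 2 : ℝ) = P ^ t * Q ^ (1 / 2 : ℝ) := by
  have hc (s : ℝ) : Commute (P ^ s) (Q ^ (1 / 2 : ℝ)) :=
    ((h.cfc_nnreal _).symm.cfc_nnreal _).symm
  refine PosSemidef.rpow_half_eq ?_ ?_
  · have := (hP.rpow_mul_mul_rpow (hQ.rpow (1 / 2)) (t / 2)).posSemidef
    rwa [mul_assoc, ← (hc _).eq, ← mul_assoc, ← hP.rpow_add, add_halves] at this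
  · calc P ^ t * Q ^ (1 / 2 : ℝ) * (P ^ t * Q ^ (1 / 2 : ℝ))
        = P ^ t * Q ^ (1 / 2 : ℝ) * (Q ^ (1 / 2 : ℝ) * P ^ t) := by rw [(hc t).eq]
      _ = P ^ t * (Q ^ (1 / 2 : ℝ) * Q ^ (1 / 2 : ℝ)) * P ^ t := by simp only [mul_assoc]
      _ = P ^ t * Q * P ^ t := by rw [hQ.posSemidef.rpow_half_mul_self]

theorem PosDef.fidelityPath_of_commute (hP : P.PosDef) (hQ : Q.PosDef) (h : Commute P Q)
    (x : ℝ) : fidelityPath P Q x = trace (P ^ (1 / 2 : ℝ) * Q ^ (1 / 2 : ℝ)) := by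
  rw [fidelityPath, hP.rpow_half_conj_of_commute hQ h, ← mul_assoc, ← hP.rpow_add]
  ring_nf

end Symmetry

end Matrix

/-! ### Fidelities -/

section Fidelity

open Matrix

variable {d : ℕ} {P Q : Matrix (Fin d) (Fin d) ℂ}

theorem generalizedFidelity_rpow_left (hP : P.PosDef) (x : ℝ) :
    generalizedFidelity (P ^ x) P Q = fidelityPath P Q x := by
  have hs : (P ^ x) ^ (1 / 2 : ℝ) = P ^ (x / 2) := by rw [hP.rpow_rpow]; ring_nf
  have h : (P ^ (x / 2) * P * P ^ (x / 2)) ^ (1 / 2 : ℝ) = P ^ ((1 + x) / 2) := by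
    have hP1 : P ^ (1 : ℝ) = P := CFC.rpow_one P hP.posSemidef.nonneg
    conv_lhs => enter [1, 1, 2]; rw [← hP1]
    rw [← hP.rpow_add, ← hP.rpow_add, hP.rpow_rpow]
    ring_nf
  rw [generalizedFidelity, hs, h, ← hP.rpow_neg_eq_inv, ← hP.rpow_add, fidelityPath]
  ring_nf

theorem generalizedFidelity_rpow_right (hQ : Q.PosDef) (x : ℝ) :
    generalizedFidelity (Q ^ x) P Q = fidelityPath Q P x := by
  have hs : (Q ^ x) ^ (1 / 2 : ℝ) = Q ^ (x / 2) := by rw [hQ.rpow_rpow]; ring_nf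
  have h : (Q ^ (x / 2) * Q * Q ^ (x / 2)) ^ (1 / 2 : ℝ) = Q ^ ((1 + x) / 2) := by
    have hQ1 : Q ^ (1 : ℝ) = Q := CFC.rpow_one Q hQ.posSemidef.nonneg
    conv_lhs => enter [1, 1, 2]; rw [← hQ1]
    rw [← hQ.rpow_add, ← hQ.rpow_add, hQ.rpow_rpow]
    ring_nf
  rw [generalizedFidelity, hs, h, ← hQ.rpow_neg_eq_inv, mul_assoc, ← hQ.rpow_add, trace_mul_comm,
    fidelityPath]
  ring_nf

theorem re_fidelityPath_one (hP : P.PosDef) : (fidelityPath P Q 1).re = uhlmannFidelity P Q := by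
  rw [fidelityPath, uhlmannFidelity, sub_self, zero_div, CFC.rpow_zero P hP.posSemidef.nonneg,
    one_mul]

theorem re_fidelityPath_neg_one (hP : P.PosDef) :
    (fidelityPath P Q (-1)).re = matsumotoFidelity P Q := by
  rw [fidelityPath, matsumotoFidelity, trace_mul_comm _ (P ^ (1 / 2 : ℝ)), ← mul_assoc,
    ← hP.rpow_add]
  norm_num

theorem uhlmannFidelity_comm (hP : P.PosDef) (hQ : Q.PosDef) :
    uhlmannFidelity P Q = uhlmannFidelity Q P := by
  have hPh := (hP.rpow (1 / 2)).isHermitian.eq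
  have hQh := (hQ.rpow (1 / 2)).isHermitian.eq
  have := trace_rpow_half_conjTranspose_mul_self
    ((hQ.rpow (1 / 2)).isUnit.mul (hP.rpow (1 / 2)).isUnit)
  rw [conjTranspose_mul, hPh, hQh] at this
  have h₁ : P ^ (1 / 2 : ℝ) * Q ^ (1 / 2 : ℝ) * (Q ^ (1 / 2 : ℝ) * P ^ (1 / 2 : ℝ)) =
      P ^ (1 / 2 : ℝ) * Q * P ^ (1 / 2 : ℝ) := by
    conv_rhs => rw [← hQ.posSemidef.rpow_half_mul_self]
    simp only [mul_assoc]
  have h₂ : Q ^ (1 / 2 : ℝ) * P ^ (1 / 2 : ℝ) * (P ^ (1 / 2 : ℝ) * Q ^ (1 / 2 : ℝ)) =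
      Q ^ (1 / 2 : ℝ) * P * Q ^ (1 / 2 : ℝ) := by
    conv_rhs => rw [← hP.posSemidef.rpow_half_mul_self]
    simp only [mul_assoc]
  rw [h₁, h₂] at this
  rw [uhlmannFidelity, uhlmannFidelity, this]

theorem matsumotoFidelity_comm (hP : P.PosDef) (hQ : Q.PosDef) :
    matsumotoFidelity P Q = matsumotoFidelity Q P :=
  congrArg (fun C => (trace C).re) (hP.geometricMean_comm hQ)

theorem ofReal_re_fidelityPath (P Q : Matrix (Fin d) (Fin d) ℂ) (x : ℝ) :
    ((fidelityPath P Q x).re : ℂ) = fidelityPath P Q x :=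
  Complex.conj_eq_iff_re.mp (Complex.conj_eq_iff_im.mpr (fidelityPath_im P Q x))

theorem polarFidelity_eq_ofReal (hP : P.PosDef) (hQ : Q.PosDef) (x : ℝ) :
    polarFidelity x P Q = (((fidelityPath P Q x).re + (fidelityPath Q P x).re) / 2 : ℝ) := by
  rw [polarFidelity, generalizedFidelity_rpow_left hP, generalizedFidelity_rpow_right hQ]
  push_cast
  rw [ofReal_re_fidelityPath, ofReal_re_fidelityPath]

theorem image_ofReal_eq_of_monotoneOn {F : ℝ → ℂ} {g : ℝ → ℝ} {a b m M : ℝ} (hab : a ≤ b)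
    (hF : ∀ x, F x = g x) (hg : ContinuousOn g (Set.Icc a b)) (hm : MonotoneOn g (Set.Icc a b))
    (ha : g a = m) (hb : g b = M) :
    F '' Set.Icc a b = ((↑) : ℝ → ℂ) '' Set.Icc m M := by
  have himg : g '' Set.Icc a b = Set.Icc m M := by
    subst ha hb
    exact Set.Subset.antisymm hm.image_Icc_subset (intermediate_value_Icc hab hg)
  rw [← himg, Set.image_image]
  exact Set.image_congr fun x _ => hF x

theorem image_generalizedFidelity_rpow_left (hP : P.PosDef) (hQ : Q.PosDef) :
    (fun x : ℝ => generalizedFidelity (P ^ x) P Q) '' Set.Icc (-1) 1 =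
      ((↑) : ℝ → ℂ) '' Set.Icc (matsumotoFidelity P Q) (uhlmannFidelity P Q) :=
  image_ofReal_eq_of_monotoneOn (by norm_num)
    (fun x => by rw [generalizedFidelity_rpow_left hP, ofReal_re_fidelityPath])
    (hP.continuousOn_re_fidelityPath hQ) (hP.monotoneOn_re_fidelityPath hQ)
    (re_fidelityPath_neg_one hP) (re_fidelityPath_one hP)

theorem image_generalizedFidelity_rpow_right (hP : P.PosDef) (hQ : Q.PosDef) :
    (fun x : ℝ => generalizedFidelity (Q ^ x) P Q) '' Set.Icc (-1) 1 =
      ((↑) : ℝ → ℂ) '' Set.Icc (matsumotoFidelity P Q) (uhlmannFidelity P Q) :=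
  image_ofReal_eq_of_monotoneOn (by norm_num)
    (fun x => by rw [generalizedFidelity_rpow_right hQ, ofReal_re_fidelityPath])
    (hQ.continuousOn_re_fidelityPath hP) (hQ.monotoneOn_re_fidelityPath hP)
    (by rw [re_fidelityPath_neg_one hQ, matsumotoFidelity_comm hQ hP])
    (by rw [re_fidelityPath_one hQ, uhlmannFidelity_comm hQ hP])

theorem image_polarFidelity (hP : P.PosDef) (hQ : Q.PosDef) :
    (fun x : ℝ => polarFidelity x P Q) '' Set.Icc (-1) 1 =
      ((↑) : ℝ → ℂ) '' Set.Icc (matsumotoFidelity P Q) (uhlmannFidelity P Q) :=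
  image_ofReal_eq_of_monotoneOn (by norm_num) (polarFidelity_eq_ofReal hP hQ)
    (((hP.continuousOn_re_fidelityPath hQ).add (hQ.continuousOn_re_fidelityPath hP)).div_const 2)
    (fun x hx y hy hxy => by
      have h₁ := hP.monotoneOn_re_fidelityPath hQ hx hy hxy
      have h₂ := hQ.monotoneOn_re_fidelityPath hP hx hy hxy
      dsimp only at h₁ h₂ ⊢
      linarith)
    (by rw [re_fidelityPath_neg_one hP, re_fidelityPath_neg_one hQ, matsumotoFidelity_comm hQ hP,
      add_self_div_two])
    (by rw [re_fidelityPath_one hP, re_fidelityPath_one hQ, uhlmannFidelity_comm hQ hP,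
      add_self_div_two])

theorem matsumotoFidelity_eq_uhlmannFidelity_of_commute (hP : P.PosDef) (hQ : Q.PosDef)
    (h : Commute P Q) : matsumotoFidelity P Q = uhlmannFidelity P Q := by
  rw [← re_fidelityPath_neg_one hP, ← re_fidelityPath_one hP, hP.fidelityPath_of_commute hQ h,
    hP.fidelityPath_of_commute hQ h]

end Fidelity

theorem mainTheorem8 (d : ℕ) :
    -- (i) exact realization of the interval `[F^M(P,Q), F^U(P,Q)]`
    (∀ P Q : PDMatrix d,
      (fun x : ℝ => generalizedFidelity (P.1 ^ x) P.1 Q.1) '' Set.Icc (-1) 1 =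
          ((↑) : ℝ → ℂ) '' Set.Icc (matsumotoFidelity P.1 Q.1) (uhlmannFidelity P.1 Q.1) ∧
      (fun x : ℝ => generalizedFidelity (Q.1 ^ x) P.1 Q.1) '' Set.Icc (-1) 1 =
          ((↑) : ℝ → ℂ) '' Set.Icc (matsumotoFidelity P.1 Q.1) (uhlmannFidelity P.1 Q.1) ∧
      (fun x : ℝ => polarFidelity x P.1 Q.1) '' Set.Icc (-1) 1 =
          ((↑) : ℝ → ℂ) '' Set.Icc (matsumotoFidelity P.1 Q.1) (uhlmannFidelity P.1 Q.1) ∧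
      ∀ x ∈ Set.Icc (-1 : ℝ) 1,
        (polarFidelity x P.1 Q.1).im = 0 ∧
        matsumotoFidelity P.1 Q.1 ≤ (polarFidelity x P.1 Q.1).re ∧
        (polarFidelity x P.1 Q.1).re ≤ uhlmannFidelity P.1 Q.1) ∧
    -- (ii) pointwise realization of every function between `F^M` and `F^U`
    (∀ G : PDMatrix d → PDMatrix d → ℝ,
      (∀ P Q : PDMatrix d,
        matsumotoFidelity P.1 Q.1 ≤ G P Q ∧ G P Q ≤ uhlmannFidelity P.1 Q.1) →
      ∀ P Q : PDMatrix d,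
        (∃ θP ∈ Set.Icc (-1 : ℝ) 1, ∃ θQ ∈ Set.Icc (-1 : ℝ) 1, ∃ ϑ ∈ Set.Icc (-1 : ℝ) 1,
          (G P Q : ℂ) = generalizedFidelity (P.1 ^ θP) P.1 Q.1 ∧
          (G P Q : ℂ) = generalizedFidelity (Q.1 ^ θQ) P.1 Q.1 ∧
          (G P Q : ℂ) = polarFidelity ϑ P.1 Q.1) ∧
        -- the parameters need not be unique: for commuting `P`, `Q` all of them work
        (P.1 * Q.1 = Q.1 * P.1 → ∀ x ∈ Set.Icc (-1 : ℝ) 1,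
          (G P Q : ℂ) = generalizedFidelity (P.1 ^ x) P.1 Q.1 ∧
          (G P Q : ℂ) = generalizedFidelity (Q.1 ^ x) P.1 Q.1 ∧
          (G P Q : ℂ) = polarFidelity x P.1 Q.1)) := by
  refine ⟨fun P Q => ⟨image_generalizedFidelity_rpow_left P.2 Q.2,
    image_generalizedFidelity_rpow_right P.2 Q.2, image_polarFidelity P.2 Q.2, fun x hx => ?_⟩,
    fun G hG P Q => ⟨?_, fun hPQ x hx => ?_⟩⟩
  · obtain ⟨r, hr, hrx⟩ := (image_polarFidelity P.2 Q.2).subset (Set.mem_image_of_mem _ hx)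
    have hrx' : (r : ℂ) = polarFidelity x P.1 Q.1 := hrx
    rw [← hrx']
    exact ⟨Complex.ofReal_im r, hr⟩
  · have hmem := Set.mem_image_of_mem ((↑) : ℝ → ℂ) (Set.mem_Icc.mpr (hG P Q))
    obtain ⟨θP, hθP, h₁⟩ := (image_generalizedFidelity_rpow_left P.2 Q.2).superset hmem
    obtain ⟨θQ, hθQ, h₂⟩ := (image_generalizedFidelity_rpow_right P.2 Q.2).superset hmem
    obtain ⟨ϑ, hϑ, h₃⟩ := (image_polarFidelity P.2 Q.2).superset hmem
    exact ⟨θP, hθP, θQ, hθQ, ϑ, hϑ, h₁.symm, h₂.symm, h₃.symm⟩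
  · -- For commuting `P` and `Q` the interval `[F^M, F^U]` is a single point, which contains both
    -- `G P Q` and all the fidelities.
    have hMU := matsumotoFidelity_eq_uhlmannFidelity_of_commute P.2 Q.2 hPQ
    have hpoint {z : ℂ} (hz : z ∈ ((↑) : ℝ → ℂ) ''
        Set.Icc (matsumotoFidelity P.1 Q.1) (uhlmannFidelity P.1 Q.1)) : (G P Q : ℂ) = z := by
      obtain ⟨r, hr, rfl⟩ := hz
      have hGPQ := hG P Q
      exact congrArg _ (by linarith [hr.1, hr.2, hGPQ.1, hGPQ.2])
    exact ⟨hpoint ((image_generalizedFidelity_rpow_left P.2 Q.2).subset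
        (Set.mem_image_of_mem _ hx)),
      hpoint ((image_generalizedFidelity_rpow_right P.2 Q.2).subset (Set.mem_image_of_mem _ hx)),
      hpoint ((image_polarFidelity P.2 Q.2).subset (Set.mem_image_of_mem _ hx))⟩
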